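/- Let $A_0,A_1\in\mathbb{R}^{n\times n}$ and $\tau\ge 0$. Suppose that the time-delay system $\dot x(t)=A_0x(t)+A_1x(t-\tau)$, $t>0$, is exponentially stable: for every solution $x$ that is continuous on $[-\tau,\infty)$ there are constants $M>0$, $\beta>0$ with $\|x(t)\|\le M e^{-\beta t}$ for all $t\ge 0$, where $\|\cdot\|$ is the Euclidean norm. For $c\in\mathbb{R}$ let $L_c:\mathbb{R}^{n\times n}\to\mathbb{R}^{n\times n}$ be the linear operator $$L_c(X)=Z_2(\tau/2)^T(A_0-cI)+(A_0^T+cI)Z_2(\tau/2)+Z_1(\tau/2)^TA_1+A_1^TZ_1(\tau/2),$$ where $Z_1,Z_2:[0,\tau/2]\to\mathbb{R}^{n\times n}$ is the unique solution of the initial value problem $$Z_1'(t)=Z_1(t)A_0+Z_2(t)^TA_1,\qquad Z_2'(t)=-Z_1(t)^TA_1-Z_2(t)A_0,\qquad Z_1(0)=Z_2(0)=X.$$ Then $L_c$ is nonsingular (bijective) for every real $c\ne 0$. -/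

import Mathlib

open scoped Matrix

namespace DelayLyapunov

variable {n : ℕ}

/-- `x` is a solution of the unforced time-delay system `x'(t) = A₀ x(t) + A₁ x(t - τ)`, `t > 0`,
with continuous initial data on `[-τ, 0]`. -/
structure IsSolution (A₀ A₁ : Matrix (Fin n) (Fin n) ℝ) (τ : ℝ) (x : ℝ → Fin n → ℝ) : Prop where
  continuousOn : ContinuousOn x (Set.Ici (-τ))
  hasDerivAt : ∀ t : ℝ, 0 < t → HasDerivAt x (A₀ *ᵥ x t + A₁ *ᵥ x (t - τ)) t

/-- Exponential stability: every solution `x` of the unforced system satisfies, in the Euclidean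
norm, `‖x(t)‖ ≤ M exp(-β t)` for all `t ≥ 0`, for some constants `M, β > 0`. -/
def ExponentiallyStable (A₀ A₁ : Matrix (Fin n) (Fin n) ℝ) (τ : ℝ) : Prop :=
  ∀ x : ℝ → Fin n → ℝ, IsSolution A₀ A₁ τ x →
    ∃ M β : ℝ, 0 < M ∧ 0 < β ∧
      ∀ t : ℝ, 0 ≤ t → ‖WithLp.toLp 2 (x t)‖ ≤ M * Real.exp (-β * t)

/-- `(Z₁, Z₂)` solves on `[0, τ/2]` the matrix initial value problem
`Z₁' = Z₁ A₀ + Z₂ᵀ A₁`, `Z₂' = -Z₁ᵀ A₁ - Z₂ A₀`, `Z₁(0) = Z₂(0) = X`. -/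
structure IsZPair (A₀ A₁ : Matrix (Fin n) (Fin n) ℝ) (τ : ℝ) (X : Matrix (Fin n) (Fin n) ℝ)
    (Z₁ Z₂ : ℝ → Matrix (Fin n) (Fin n) ℝ) : Prop where
  init₁ : Z₁ 0 = X
  init₂ : Z₂ 0 = X
  deriv₁ : ∀ t ∈ Set.Icc 0 (τ / 2),
    HasDerivWithinAt Z₁ (Z₁ t * A₀ + (Z₂ t)ᵀ * A₁) (Set.Icc 0 (τ / 2)) t
  deriv₂ : ∀ t ∈ Set.Icc 0 (τ / 2),
    HasDerivWithinAt Z₂ (-((Z₁ t)ᵀ * A₁) - Z₂ t * A₀) (Set.Icc 0 (τ / 2)) t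

/-- The linear vector field of the system for `(Z₁, Z₂)`. -/
def field (A₀ A₁ : Matrix (Fin n) (Fin n) ℝ) :
    (Matrix (Fin n) (Fin n) ℝ × Matrix (Fin n) (Fin n) ℝ) →ₗ[ℝ]
      (Matrix (Fin n) (Fin n) ℝ × Matrix (Fin n) (Fin n) ℝ) where
  toFun p := (p.1 * A₀ + p.2ᵀ * A₁, -(p.1ᵀ * A₁) - p.2 * A₀)
  map_add' p q := by
    ext1 <;> simp [add_mul] <;> abel
  map_smul' r p := by
    ext1 <;> simp [smul_sub]

theorem exists_linear_flow {E : Type*} [NormedAddCommGroup E] [NormedSpace ℝ E] [CompleteSpace E]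
    (B : E →L[ℝ] E) (x : E) : ∃ z : ℝ → E, z 0 = x ∧ ∀ t, HasDerivAt z (B (z t)) t := by
  refine ⟨fun s => NormedSpace.exp (s • B) x, by simp, fun t => ?_⟩
  have h := (hasDerivAt_exp_smul_const' (𝕂 := ℝ) B t).clm_apply (hasDerivAt_const t x)
  simpa using h

theorem linear_flow_eqOn {E : Type*} [NormedAddCommGroup E] [NormedSpace ℝ E]
    (B : E →L[ℝ] E) {T : ℝ} {z y : ℝ → E} (h0 : z 0 = y 0)
    (hz : ∀ t ∈ Set.Icc 0 T, HasDerivWithinAt z (B (z t)) (Set.Icc 0 T) t)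
    (hy : ∀ t ∈ Set.Icc 0 T, HasDerivWithinAt y (B (y t)) (Set.Icc 0 T) t) :
    Set.EqOn z y (Set.Icc 0 T) := by
  refine ODE_solution_unique (v := fun _ p => B p) (K := ‖B‖₊)
    (fun t => B.lipschitz)
    (fun t ht => (hz t ht).continuousWithinAt) ?_
    (fun t ht => (hy t ht).continuousWithinAt) ?_ h0
  · intro t ht
    exact (hz t ⟨ht.1, ht.2.le⟩).mono_of_mem_nhdsWithin (Icc_mem_nhdsGE_of_mem ht)
  · intro t ht
    exact (hy t ⟨ht.1, ht.2.le⟩).mono_of_mem_nhdsWithin (Icc_mem_nhdsGE_of_mem ht)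

/-- Matrices as plain functions, which carry the (sup-)norm used in the proofs below. -/
abbrev Mat (n : ℕ) : Type := Fin n → Fin n → ℝ

/-- The vector field as a continuous linear map. -/
noncomputable def fieldL (A₀ A₁ : Matrix (Fin n) (Fin n) ℝ) :
    (Mat n × Mat n) →L[ℝ] (Mat n × Mat n) :=
  LinearMap.toContinuousLinearMap (E := Mat n × Mat n) (field A₀ A₁)

theorem exists_isZPair (A₀ A₁ : Matrix (Fin n) (Fin n) ℝ) (τ : ℝ)
    (X : Matrix (Fin n) (Fin n) ℝ) :
    ∃ Z₁ Z₂ : ℝ → Matrix (Fin n) (Fin n) ℝ, IsZPair A₀ A₁ τ X Z₁ Z₂ := by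
  obtain ⟨z, h0, hz⟩ := exists_linear_flow (fieldL A₀ A₁) (X, X)
  have h1 : ∀ t, HasDerivAt (F := Mat n) (fun s => (z s).1) (fieldL A₀ A₁ (z t)).1 t := fun t =>
    (ContinuousLinearMap.fst ℝ (Mat n) (Mat n)).hasFDerivAt.comp_hasDerivAt t (hz t)
  have h2 : ∀ t, HasDerivAt (F := Mat n) (fun s => (z s).2) (fieldL A₀ A₁ (z t)).2 t := fun t =>
    (ContinuousLinearMap.snd ℝ (Mat n) (Mat n)).hasFDerivAt.comp_hasDerivAt t (hz t)
  exact ⟨fun s => (z s).1, fun s => (z s).2, congrArg Prod.fst h0, congrArg Prod.snd h0,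
    fun t _ => (h1 t).hasDerivWithinAt, fun t _ => (h2 t).hasDerivWithinAt⟩

theorem IsZPair.eqOn {A₀ A₁ : Matrix (Fin n) (Fin n) ℝ} {τ : ℝ}
    {X : Matrix (Fin n) (Fin n) ℝ} {Z₁ Z₂ Y₁ Y₂ : ℝ → Matrix (Fin n) (Fin n) ℝ}
    (hZ : IsZPair A₀ A₁ τ X Z₁ Z₂) (hY : IsZPair A₀ A₁ τ X Y₁ Y₂) :
    Set.EqOn Z₁ Y₁ (Set.Icc 0 (τ / 2)) ∧ Set.EqOn Z₂ Y₂ (Set.Icc 0 (τ / 2)) := by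
  have hmain := linear_flow_eqOn (fieldL A₀ A₁) (T := τ / 2)
    (z := fun s => (Z₁ s, Z₂ s)) (y := fun s => (Y₁ s, Y₂ s))
    (Prod.ext (hZ.init₁.trans hY.init₁.symm) (hZ.init₂.trans hY.init₂.symm))
    (fun t ht => HasDerivWithinAt.prodMk (F := Mat n) (G := Mat n)
      (hZ.deriv₁ t ht) (hZ.deriv₂ t ht))
    (fun t ht => HasDerivWithinAt.prodMk (F := Mat n) (G := Mat n)
      (hY.deriv₁ t ht) (hY.deriv₂ t ht))
  exact ⟨fun t ht => congrArg Prod.fst (hmain ht), fun t ht => congrArg Prod.snd (hmain ht)⟩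

/-- The first component `Z₁` of the solution of the initial value problem with value `X` at `0`. -/
noncomputable def Z₁ (A₀ A₁ : Matrix (Fin n) (Fin n) ℝ) (τ : ℝ) (X : Matrix (Fin n) (Fin n) ℝ) :
    ℝ → Matrix (Fin n) (Fin n) ℝ :=
  (exists_isZPair A₀ A₁ τ X).choose

/-- The second component `Z₂` of the solution of the initial value problem with value `X` at `0`. -/
noncomputable def Z₂ (A₀ A₁ : Matrix (Fin n) (Fin n) ℝ) (τ : ℝ) (X : Matrix (Fin n) (Fin n) ℝ) :
    ℝ → Matrix (Fin n) (Fin n) ℝ :=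
  (exists_isZPair A₀ A₁ τ X).choose_spec.choose

theorem isZPair (A₀ A₁ : Matrix (Fin n) (Fin n) ℝ) (τ : ℝ) (X : Matrix (Fin n) (Fin n) ℝ) :
    IsZPair A₀ A₁ τ X (Z₁ A₀ A₁ τ X) (Z₂ A₀ A₁ τ X) :=
  (exists_isZPair A₀ A₁ τ X).choose_spec.choose_spec

theorem IsZPair.add {A₀ A₁ : Matrix (Fin n) (Fin n) ℝ} {τ : ℝ}
    {X Y : Matrix (Fin n) (Fin n) ℝ} {Z₁ Z₂ Y₁ Y₂ : ℝ → Matrix (Fin n) (Fin n) ℝ}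
    (hZ : IsZPair A₀ A₁ τ X Z₁ Z₂) (hY : IsZPair A₀ A₁ τ Y Y₁ Y₂) :
    IsZPair A₀ A₁ τ (X + Y) (Z₁ + Y₁) (Z₂ + Y₂) where
  init₁ := by simp [hZ.init₁, hY.init₁]
  init₂ := by simp [hZ.init₂, hY.init₂]
  deriv₁ t ht := by
    have e : (Z₁ + Y₁) t * A₀ + ((Z₂ + Y₂) t)ᵀ * A₁ =
        (Z₁ t * A₀ + (Z₂ t)ᵀ * A₁) + (Y₁ t * A₀ + (Y₂ t)ᵀ * A₁) := by
      simp only [Pi.add_apply, Matrix.transpose_add, add_mul]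
      abel
    rw [e]
    exact HasDerivWithinAt.add (F := Mat n) (hZ.deriv₁ t ht) (hY.deriv₁ t ht)
  deriv₂ t ht := by
    have e : -(((Z₁ + Y₁) t)ᵀ * A₁) - (Z₂ + Y₂) t * A₀ =
        (-((Z₁ t)ᵀ * A₁) - Z₂ t * A₀) + (-((Y₁ t)ᵀ * A₁) - Y₂ t * A₀) := by
      simp only [Pi.add_apply, Matrix.transpose_add, add_mul]
      abel
    rw [e]
    exact HasDerivWithinAt.add (F := Mat n) (hZ.deriv₂ t ht) (hY.deriv₂ t ht)

theorem IsZPair.smul {A₀ A₁ : Matrix (Fin n) (Fin n) ℝ} {τ : ℝ}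
    {X : Matrix (Fin n) (Fin n) ℝ} {Z₁ Z₂ : ℝ → Matrix (Fin n) (Fin n) ℝ}
    (r : ℝ) (hZ : IsZPair A₀ A₁ τ X Z₁ Z₂) :
    IsZPair A₀ A₁ τ (r • X) (r • Z₁) (r • Z₂) where
  init₁ := by simp [hZ.init₁]
  init₂ := by simp [hZ.init₂]
  deriv₁ t ht := by
    have e : (r • Z₁) t * A₀ + ((r • Z₂) t)ᵀ * A₁ = r • (Z₁ t * A₀ + (Z₂ t)ᵀ * A₁) := by
      simp [smul_add]
    rw [e]
    exact HasDerivWithinAt.const_smul (F := Mat n) r (hZ.deriv₁ t ht)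
  deriv₂ t ht := by
    have e : -(((r • Z₁) t)ᵀ * A₁) - (r • Z₂) t * A₀ = r • (-((Z₁ t)ᵀ * A₁) - Z₂ t * A₀) := by
      simp [smul_sub]
    rw [e]
    exact HasDerivWithinAt.const_smul (F := Mat n) r (hZ.deriv₂ t ht)

/-- The linear operator `L_c(X) = Z₂(τ/2)ᵀ (A₀ - c I) + (A₀ᵀ + c I) Z₂(τ/2) + Z₁(τ/2)ᵀ A₁
+ A₁ᵀ Z₁(τ/2)`, where `(Z₁, Z₂)` is the unique solution on `[0, τ/2]` of the initial value problem
with `Z₁(0) = Z₂(0) = X`. -/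
noncomputable def Lc (A₀ A₁ : Matrix (Fin n) (Fin n) ℝ) (τ : ℝ) (hτ : 0 ≤ τ) (c : ℝ) :
    Matrix (Fin n) (Fin n) ℝ →ₗ[ℝ] Matrix (Fin n) (Fin n) ℝ where
  toFun X :=
    (Z₂ A₀ A₁ τ X (τ / 2))ᵀ * (A₀ - c • 1) + (A₀ᵀ + c • 1) * Z₂ A₀ A₁ τ X (τ / 2)
      + (Z₁ A₀ A₁ τ X (τ / 2))ᵀ * A₁ + A₁ᵀ * Z₁ A₀ A₁ τ X (τ / 2)
  map_add' X Y := by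
    have hmem : τ / 2 ∈ Set.Icc 0 (τ / 2) := ⟨by positivity, le_rfl⟩
    have h := (isZPair A₀ A₁ τ (X + Y)).eqOn ((isZPair A₀ A₁ τ X).add (isZPair A₀ A₁ τ Y))
    rw [h.1 hmem, h.2 hmem]
    simp only [Pi.add_apply, Matrix.transpose_add, add_mul, mul_add]
    abel
  map_smul' r X := by
    have hmem : τ / 2 ∈ Set.Icc 0 (τ / 2) := ⟨by positivity, le_rfl⟩
    have h := (isZPair A₀ A₁ τ (r • X)).eqOn ((isZPair A₀ A₁ τ X).smul r)
    rw [h.1 hmem, h.2 hmem]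
    simp only [Pi.smul_apply, Matrix.transpose_smul, Matrix.smul_mul, Matrix.mul_smul, smul_add,
      RingHom.id_apply]

end DelayLyapunov

/-!
Since `L_c` is an endomorphism of a finite-dimensional space, it is enough to show that its kernel
is trivial. Let `L_c X = 0`. The solution of the initial value problem exists on the whole line,
where time reversal exchanges `Z₁` and `Z₂`; hence `V t = Z₁ (t - τ / 2)` satisfies
`V'(t) = V(t) A₀ + V(τ - t)ᵀ A₁` for all `t` (`exists_isLyapunovFlow`), with `V 0 = Z₂ (τ / 2)`,
`V τ = Z₁ (τ / 2)` and `V (τ / 2) = X`. The matrix `L_c X` is the sum of an antisymmetric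
part `c (V 0 - (V 0)ᵀ)` and of a symmetric part that does not involve `c`. Both vanish and `c ≠ 0`,
so `V 0` is symmetric and
`V 0 A₀ + A₀ᵀ V 0 + (V τ)ᵀ A₁ + A₁ᵀ V τ = 0`: on `[0, τ]`, `V` is a delay Lyapunov matrix for the
weight `0`. It remains to see that such a `V` vanishes (`IsLyapunovFlow.eq_zero`).

The Lyapunov functional of `V` is constant along solutions. To avoid double integrals it is used as
a bilinear form and built in two stages. For a solution `x`, the costate
`q(t) = V 0 x(t) + ∫₀^τ V(s)ᵀ A₁ x(t + s - τ) ds`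
solves the advanced equation `q'(t) = -A₀ᵀ q(t) - A₁ᵀ q(t + τ)` (`hasDerivAt_costate`), so for every
solution `y` the quantity `q(t) · y(t) + ∫₀^τ q(t + s) · A₁ y(t + s - τ) ds` does not depend on
`t ≥ 0`. By exponential stability it tends to `0`, hence it is `0` at `t = 0`
(`costate_pairing_eq_zero`). The initial function of `y` is an arbitrary continuous function
(`exists_solution`), so `q(0) = 0`; the initial function of `x` is arbitrary too, so `V 0 = 0` and
`V(s)ᵀ A₁ = 0` on `[0, τ]` if `τ > 0`. The equation of `V` reduces to `V' = V A₀`, and `V = 0` by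
uniqueness.
-/

open scoped Matrix

namespace DelayLyapunov

variable {n : ℕ}

open Filter Topology MeasureTheory

/-! ### Integrals over moving windows -/

/-- The part of Leibniz' rule that comes from the upper endpoint. The integral is taken over a
shrinking interval, so the dependence of the integrand on the parameter contributes nothing and
continuity of `F` is enough. -/
theorem hasDerivAt_integral_moving_endpoint {E : Type*} [NormedAddCommGroup E] [NormedSpace ℝ E]
    [CompleteSpace E] {F : ℝ → ℝ → E} (hF : Continuous (Function.uncurry F)) (t₀ b : ℝ) :
    HasDerivAt (fun t => ∫ u in (t₀ + b)..(t + b), F t u) (F t₀ (t₀ + b)) t₀ := by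
  rw [hasDerivAt_iff_isLittleO, Asymptotics.isLittleO_iff]
  intro ε hε
  obtain ⟨δ, hδ, h⟩ := Metric.continuousAt_iff.1 (hF.continuousAt (x := (t₀, t₀ + b))) ε hε
  filter_upwards [Metric.ball_mem_nhds t₀ hδ] with t ht
  rw [Metric.mem_ball, Real.dist_eq] at ht
  have hi : ∀ c d, IntervalIntegrable (F t) volume c d := fun c d =>
    (hF.comp (Continuous.prodMk_right t)).intervalIntegrable c d
  have e : (t - t₀) • F t₀ (t₀ + b) = ∫ _ in (t₀ + b)..(t + b), F t₀ (t₀ + b) := by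
    rw [intervalIntegral.integral_const]; congr 1; ring
  rw [intervalIntegral.integral_same, sub_zero, e,
    ← intervalIntegral.integral_sub (hi _ _) (by simp)]
  have key := intervalIntegral.norm_integral_le_of_norm_le_const (a := t₀ + b) (b := t + b)
    (f := fun u => F t u - F t₀ (t₀ + b)) (C := ε) (fun u hu => by
      have hu' : |u - (t₀ + b)| < δ := by
        have := Set.abs_sub_left_of_mem_uIcc (Set.uIoc_subset_uIcc hu)
        refine lt_of_le_of_lt this ?_
        simpa using ht
      have := @h (t, u) (by
        rw [Prod.dist_eq, max_lt_iff]
        exact ⟨by simpa [Real.dist_eq] using ht, by simpa [Real.dist_eq] using hu'⟩)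
      rw [dist_eq_norm] at this
      exact this.le)
  simpa [Real.norm_eq_abs] using key

/-- Leibniz' rule over a window of constant length that moves with the parameter. -/
theorem hasDerivAt_integral_window {E : Type*} [NormedAddCommGroup E] [NormedSpace ℝ E]
    [CompleteSpace E] {F F' : ℝ → ℝ → E} (hF : Continuous (Function.uncurry F))
    (hF' : Continuous (Function.uncurry F')) (hd : ∀ t u, HasDerivAt (fun s => F s u) (F' t u) t)
    (a b t₀ : ℝ) :
    HasDerivAt (fun t => ∫ u in (t + a)..(t + b), F t u)
      (F t₀ (t₀ + b) - F t₀ (t₀ + a) + ∫ u in (t₀ + a)..(t₀ + b), F' t₀ u) t₀ := by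
  have hi : ∀ t c d, IntervalIntegrable (F t) volume c d := fun t c d =>
    (hF.comp (Continuous.prodMk_right t)).intervalIntegrable c d
  obtain ⟨C, hC⟩ := ((isCompact_closedBall t₀ 1).prod
    (isCompact_uIcc (a := t₀ + a) (b := t₀ + b))).exists_bound_of_continuousOn hF'.continuousOn
  have hfix : HasDerivAt (fun t => ∫ u in (t₀ + a)..(t₀ + b), F t u)
      (∫ u in (t₀ + a)..(t₀ + b), F' t₀ u) t₀ := by
    refine (intervalIntegral.hasDerivAt_integral_of_dominated_loc_of_deriv_le (𝕜 := ℝ)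
      (bound := fun _ => C) (Metric.closedBall_mem_nhds t₀ one_pos) ?_ (hi _ _ _) ?_ ?_
      (by simp) ?_).2
    · exact Eventually.of_forall fun t =>
        (hF.comp (Continuous.prodMk_right t)).aestronglyMeasurable
    · exact (hF'.comp (Continuous.prodMk_right t₀)).aestronglyMeasurable
    · exact Eventually.of_forall fun u hu t ht =>
        hC (t, u) ⟨ht, Set.uIoc_subset_uIcc hu⟩
    · exact Eventually.of_forall fun u _ t _ => hd t u
  refine (((hasDerivAt_integral_moving_endpoint hF t₀ b).sub
    (hasDerivAt_integral_moving_endpoint hF t₀ a)).add hfix).congr_of_eventuallyEq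
    (Eventually.of_forall fun t => ?_)
  simp only [Pi.add_apply, Pi.sub_apply]
  rw [sub_add_eq_add_sub, add_comm (∫ u in (t₀ + b)..(t + b), F t u),
    intervalIntegral.integral_add_adjacent_intervals
    (hi _ _ _) (hi _ _ _), intervalIntegral.integral_interval_sub_left (hi _ _ _) (hi _ _ _)]

/-- If `f` decays and `H s` vanishes at the origin, then `H` averaged along a window of `f` that
moves to infinity decays. -/
theorem tendsto_integral_window {E F : Type*} [NormedAddCommGroup E] [ProperSpace E]
    [NormedAddCommGroup F] [NormedSpace ℝ F] {H : ℝ → E → F}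
    (hH : Continuous (Function.uncurry H)) (h0 : ∀ s, H s 0 = 0) {f : ℝ → E} (hf : Continuous f)
    (hlim : Tendsto f atTop (𝓝 0)) (a b : ℝ) :
    Tendsto (fun t => ∫ s in a..b, H s (f (t + s))) atTop (𝓝 0) := by
  obtain ⟨C, hC⟩ := ((isCompact_uIcc (a := a) (b := b)).prod
    (isCompact_closedBall (0 : E) 1)).exists_bound_of_continuousOn hH.continuousOn
  have hsmall : ∀ᶠ t in atTop, ∀ s ∈ Set.uIoc a b, f (t + s) ∈ Metric.closedBall (0 : E) 1 := by
    obtain ⟨T, hT⟩ := eventually_atTop.1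
      (hlim.eventually (Metric.closedBall_mem_nhds (0 : E) one_pos))
    filter_upwards [eventually_ge_atTop (T - min a b)] with t ht s hs
    exact hT _ (by have := hs.1; linarith)
  have key := intervalIntegral.tendsto_integral_filter_of_dominated_convergence (μ := volume)
    (a := a) (b := b) (l := atTop) (F := fun t s => H s (f (t + s))) (f := fun _ => 0)
    (fun _ => C) ?_ ?_ (by simp) ?_
  · simpa using key
  · refine Eventually.of_forall fun t => Continuous.aestronglyMeasurable ?_
    exact hH.comp (continuous_id.prodMk (hf.comp (continuous_const.add continuous_id)))
  · filter_upwards [hsmall] with t ht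
    exact Eventually.of_forall fun s hs => hC (s, f (t + s)) ⟨Set.uIoc_subset_uIcc hs, ht s hs⟩
  · refine Eventually.of_forall fun s _ => ?_
    have h1 : Tendsto (fun t => f (t + s)) atTop (𝓝 0) :=
      hlim.comp (tendsto_atTop_add_const_right _ s tendsto_id)
    have h2 := ((hH.comp (Continuous.prodMk_right s)).tendsto 0).comp h1
    simpa [Function.comp_def, h0] using h2

/-! ### Calculus of matrix and vector functions -/

theorem hasDerivAt_matrix_iff {m k : Type*} [Fintype m] [Fintype k] {A : ℝ → Matrix m k ℝ}
    {A' : Matrix m k ℝ} {t : ℝ} :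
    HasDerivAt A A' t ↔ ∀ i j, HasDerivAt (fun s => A s i j) (A' i j) t :=
  (hasDerivAt_pi (E' := fun _ : m => k → ℝ)).trans (forall_congr' fun _ => hasDerivAt_pi)

theorem hasDerivAt_transpose {m k : Type*} [Fintype m] [Fintype k] {A : ℝ → Matrix m k ℝ}
    {A' : Matrix m k ℝ} {t : ℝ} (h : HasDerivAt A A' t) :
    HasDerivAt (fun s => (A s)ᵀ) A'ᵀ t :=
  hasDerivAt_matrix_iff.2 fun i j => hasDerivAt_matrix_iff.1 h j i

theorem hasDerivAt_matrix_const {m k : Type*} [Fintype m] [Fintype k] (A : Matrix m k ℝ) (t : ℝ) :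
    HasDerivAt (fun _ => A) 0 t :=
  hasDerivAt_matrix_iff.2 fun i j => hasDerivAt_const t (A i j)

theorem hasDerivAt_matrix_comp_of_neg_one {m k : Type*} [Fintype m] [Fintype k]
    {A : ℝ → Matrix m k ℝ} {A' : Matrix m k ℝ} {f : ℝ → ℝ} {t : ℝ}
    (hA : HasDerivAt A A' (f t)) (hf : HasDerivAt f (-1) t) :
    HasDerivAt (fun s => A (f s)) (-A') t :=
  hasDerivAt_matrix_iff.2 fun i j => by
    simpa [Function.comp_def] using (hasDerivAt_matrix_iff.1 hA i j).comp t hf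

theorem hasDerivAt_dotProduct {k : Type*} [Fintype k] {x y : ℝ → k → ℝ} {x' y' : k → ℝ} {t : ℝ}
    (hx : HasDerivAt x x' t) (hy : HasDerivAt y y' t) :
    HasDerivAt (fun s => x s ⬝ᵥ y s) (x' ⬝ᵥ y t + x t ⬝ᵥ y') t := by
  have h := HasDerivAt.fun_sum (u := Finset.univ) fun i _ =>
    (hasDerivAt_pi.1 hx i).mul (hasDerivAt_pi.1 hy i)
  rw [Finset.sum_add_distrib] at h
  exact h

theorem hasDerivAt_mulVec {m k : Type*} [Fintype m] [Fintype k] {A : ℝ → Matrix m k ℝ}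
    {A' : Matrix m k ℝ} {x : ℝ → k → ℝ} {x' : k → ℝ} {t : ℝ} (hA : HasDerivAt A A' t)
    (hx : HasDerivAt x x' t) :
    HasDerivAt (fun s => A s *ᵥ x s) (A' *ᵥ x t + A t *ᵥ x') t :=
  hasDerivAt_pi.2 fun i =>
    hasDerivAt_dotProduct (hasDerivAt_pi.2 fun j => hasDerivAt_matrix_iff.1 hA i j) hx

theorem mulVec_intervalIntegral {m k : Type*} [Fintype m] [Fintype k] (A : Matrix m k ℝ)
    {f : ℝ → k → ℝ} (hf : Continuous f) (a b : ℝ) :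
    A *ᵥ (∫ s in a..b, f s) = ∫ s in a..b, A *ᵥ f s :=
  ((LinearMap.toContinuousLinearMap A.mulVecLin).intervalIntegral_comp_comm
    (hf.intervalIntegrable a b)).symm

/-! ### Test functions -/

/-- A functional `ψ ↦ a · ψ(0) + ∫₀^τ g(s) · ψ(s - τ) ds` that vanishes on all continuous `ψ`
is zero. -/
theorem eq_zero_of_forall_dotProduct_add_integral_eq_zero {k : Type*} [Fintype k] {τ : ℝ}
    (hτ : 0 ≤ τ) {a : k → ℝ} {g : ℝ → k → ℝ} (hg : Continuous g)
    (h : ∀ ψ : ℝ → k → ℝ, Continuous ψ →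
      a ⬝ᵥ ψ 0 + ∫ s in 0..τ, g s ⬝ᵥ ψ (s - τ) = 0) :
    a = 0 ∧ (0 < τ → ∀ s ∈ Set.Icc 0 τ, g s = 0) := by
  have hIco : ∀ s ∈ Set.Ico 0 τ, g s = 0 := by
    intro s hs
    by_contra hne
    -- the test function is `g` itself, with a weight that removes the term `a · ψ(0)`
    have h1 := h (fun u => (-u) • g (u + τ)) (by fun_prop)
    have hpos : 0 < ∫ s in 0..τ, g s ⬝ᵥ ((-(s - τ)) • g (s - τ + τ)) := by
      refine intervalIntegral.integral_pos (hs.1.trans_lt hs.2) ?_ ?_ ⟨s, ⟨hs.1, hs.2.le⟩, ?_⟩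
      · exact (Continuous.dotProduct hg (by fun_prop)).continuousOn
      · intro r hr
        rw [dotProduct_smul, smul_eq_mul, sub_add_cancel]
        exact mul_nonneg (by linarith [hr.2])
          (Finset.sum_nonneg fun i _ => mul_self_nonneg _)
      · rw [dotProduct_smul, smul_eq_mul, sub_add_cancel]
        exact mul_pos (by linarith [hs.2]) (lt_of_le_of_ne
          (Finset.sum_nonneg fun i _ => mul_self_nonneg _)
          fun h => hne (dotProduct_self_eq_zero.1 h.symm))
    simp only [neg_zero, zero_smul, dotProduct_zero, zero_add] at h1
    exact hpos.ne' h1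
  have hIcc : 0 < τ → ∀ s ∈ Set.Icc 0 τ, g s = 0 := by
    intro hτ0 s hs
    have : Set.EqOn g 0 (closure (Set.Ico 0 τ)) :=
      Set.EqOn.closure (fun s hs => hIco s hs) hg continuous_zero
    rw [closure_Ico hτ0.ne] at this
    exact this hs
  refine ⟨?_, hIcc⟩
  have h1 := h (fun _ => a) continuous_const
  have h2 : ∫ s in 0..τ, g s ⬝ᵥ a = 0 := by
    rcases hτ.eq_or_lt with rfl | h0
    · simp
    · rw [intervalIntegral.integral_congr (g := fun _ => (0 : ℝ))]
      · simp
      · intro s hs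
        rw [Set.uIcc_of_le hτ] at hs
        simp [hIcc h0 s hs]
  rw [h2, add_zero] at h1
  exact dotProduct_self_eq_zero.1 h1

/-! ### Solutions of the delay system -/

/-- The matrix `A₀` acting on vectors, as a continuous linear map. -/
noncomputable def mulVecCLM (A₀ : Matrix (Fin n) (Fin n) ℝ) : (Fin n → ℝ) →L[ℝ] (Fin n → ℝ) :=
  LinearMap.toContinuousLinearMap A₀.mulVecLin

/-- The variation-of-constants step of the method of steps: past times `t ≤ 0` follow the initial
function `φ`, and for `t ≥ 0` the delayed term is read off `x`. Its continuous fixed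
points solve the delay system with initial function `φ`. -/
noncomputable def step (A₀ A₁ : Matrix (Fin n) (Fin n) ℝ) (τ : ℝ) (φ x : ℝ → Fin n → ℝ)
    (t : ℝ) : Fin n → ℝ :=
  φ (min t 0) - φ 0 + NormedSpace.exp (max t 0 • mulVecCLM A₀)
    (φ 0 + ∫ s in 0..max t 0, NormedSpace.exp ((-s) • mulVecCLM A₀) (A₁ *ᵥ x (s - τ)))

theorem continuous_exp_smul (B : (Fin n → ℝ) →L[ℝ] (Fin n → ℝ)) :
    Continuous fun s : ℝ => NormedSpace.exp (s • B) :=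
  continuous_iff_continuousAt.2 fun s => (hasDerivAt_exp_smul_const (𝕂 := ℝ) B s).continuousAt

theorem exp_smul_mul_exp_neg_smul (B : (Fin n → ℝ) →L[ℝ] (Fin n → ℝ)) (t : ℝ) :
    NormedSpace.exp (t • B) * NormedSpace.exp ((-t) • B) = 1 := by
  let _ : NormedAlgebra ℚ ((Fin n → ℝ) →L[ℝ] (Fin n → ℝ)) := .restrictScalars ℚ ℝ _
  have hc : Commute (t • B) ((-t) • B) := ((Commute.refl B).smul_left t).smul_right (-t)
  have h0 : t • B + (-t) • B = 0 := by rw [← add_smul, add_neg_cancel, zero_smul]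
  rw [← NormedSpace.exp_add_of_commute hc, h0, NormedSpace.exp_zero]

theorem continuous_step_integrand (A₀ A₁ : Matrix (Fin n) (Fin n) ℝ) (τ : ℝ)
    {x : ℝ → Fin n → ℝ} (hx : Continuous x) :
    Continuous fun s => NormedSpace.exp ((-s) • mulVecCLM A₀) (A₁ *ᵥ x (s - τ)) :=
  ((continuous_exp_smul _).comp continuous_neg).clm_apply
    (Continuous.matrix_mulVec continuous_const (by fun_prop))

theorem continuous_step (A₀ A₁ : Matrix (Fin n) (Fin n) ℝ) (τ : ℝ) {φ x : ℝ → Fin n → ℝ}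
    (hφ : Continuous φ) (hx : Continuous x) : Continuous (step A₀ A₁ τ φ x) := by
  have hint : Continuous fun t =>
      ∫ s in 0..t, NormedSpace.exp ((-s) • mulVecCLM A₀) (A₁ *ᵥ x (s - τ)) :=
    intervalIntegral.continuous_primitive
      (fun a b => (continuous_step_integrand A₀ A₁ τ hx).intervalIntegrable a b) 0
  have hmax : Continuous fun t : ℝ => max t 0 := by fun_prop
  exact ((hφ.comp (by fun_prop)).sub continuous_const).add
    (((continuous_exp_smul _).comp hmax).clm_apply (continuous_const.add (hint.comp hmax)))

theorem step_of_nonpos (A₀ A₁ : Matrix (Fin n) (Fin n) ℝ) (τ : ℝ) (φ x : ℝ → Fin n → ℝ) {t : ℝ}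
    (ht : t ≤ 0) : step A₀ A₁ τ φ x t = φ t := by
  simp [step, ht]

theorem step_congr (A₀ A₁ : Matrix (Fin n) (Fin n) ℝ) (τ : ℝ) (φ : ℝ → Fin n → ℝ)
    {x y : ℝ → Fin n → ℝ} {T t : ℝ} (h : ∀ s ≤ T, x s = y s) (ht : t ≤ T + τ) (hT : 0 ≤ T + τ) :
    step A₀ A₁ τ φ x t = step A₀ A₁ τ φ y t := by
  unfold step
  congr 3
  refine intervalIntegral.integral_congr fun s hs => ?_
  rw [Set.uIcc_of_le (le_max_right t 0)] at hs
  have : s ≤ T + τ := hs.2.trans (max_le ht hT)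
  simp only [h (s - τ) (by linarith)]

theorem hasDerivAt_step (A₀ A₁ : Matrix (Fin n) (Fin n) ℝ) (τ : ℝ) (φ : ℝ → Fin n → ℝ)
    {x : ℝ → Fin n → ℝ} (hx : Continuous x) {t : ℝ} (ht : 0 < t) :
    HasDerivAt (step A₀ A₁ τ φ x) (A₀ *ᵥ step A₀ A₁ τ φ x t + A₁ *ᵥ x (t - τ)) t := by
  set B := mulVecCLM A₀
  have hI := ((continuous_step_integrand A₀ A₁ τ hx).integral_hasStrictDerivAt 0 t).hasDerivAt
  have h := (hasDerivAt_exp_smul_const' (𝕂 := ℝ) B t).clm_apply (hI.const_add (φ 0))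
  have hinv : ∀ v, NormedSpace.exp (t • B) (NormedSpace.exp ((-t) • B) v) = v := by
    intro v
    rw [← mul_apply_eq_comp, exp_smul_mul_exp_neg_smul]
    rfl
  have e : step A₀ A₁ τ φ x t = NormedSpace.exp (t • B)
      (φ 0 + ∫ s in 0..t, NormedSpace.exp ((-s) • B) (A₁ *ᵥ x (s - τ))) := by
    simp [step, ht.le, B]
  have e' : (B * NormedSpace.exp (t • B))
        (φ 0 + ∫ s in 0..t, NormedSpace.exp ((-s) • B) (A₁ *ᵥ x (s - τ)))
      + NormedSpace.exp (t • B) (NormedSpace.exp ((-t) • B) (A₁ *ᵥ x (t - τ)))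
      = A₀ *ᵥ step A₀ A₁ τ φ x t + A₁ *ᵥ x (t - τ) := by
    rw [hinv, mul_apply_eq_comp, ← e]
    rfl
  rw [← e']
  refine h.congr_of_eventuallyEq ?_
  filter_upwards [lt_mem_nhds ht] with s hs
  simp [step, hs.le, B]

/-- Existence for the initial value problem of the delay system, in the form of a solution that is
continuous on the whole line. -/
theorem exists_solution (A₀ A₁ : Matrix (Fin n) (Fin n) ℝ) {τ : ℝ} (hτ : 0 ≤ τ)
    {φ : ℝ → Fin n → ℝ} (hφ : Continuous φ) :
    ∃ x : ℝ → Fin n → ℝ, Continuous x ∧ IsSolution A₀ A₁ τ x ∧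
      ∀ t ∈ Set.Icc (-τ) 0, x t = φ t := by
  rcases hτ.eq_or_lt with rfl | hτ
  · -- without delay the system is an ordinary differential equation
    obtain ⟨x, h0, hx⟩ := exists_linear_flow (mulVecCLM (A₀ + A₁)) (φ 0)
    have hc : Continuous x := continuous_iff_continuousAt.2 fun t => (hx t).continuousAt
    refine ⟨x, hc, ⟨hc.continuousOn, fun t _ => ?_⟩, fun t ht => ?_⟩
    · have e : mulVecCLM (A₀ + A₁) (x t) = A₀ *ᵥ x t + A₁ *ᵥ x (t - 0) := by
        rw [sub_zero, ← Matrix.add_mulVec]; rfl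
      exact e ▸ hx t
    · obtain rfl : t = 0 := by simpa using ht
      exact h0
  -- successive steps agree on ever longer half-lines `(-∞, k τ]`, so the iteration stabilizes
  let S := step A₀ A₁ τ φ
  let y : ℕ → ℝ → Fin n → ℝ := fun k => S^[k] φ
  have hyS : ∀ k, y (k + 1) = S (y k) := fun k => Function.iterate_succ_apply' S k φ
  have hyc : ∀ k, Continuous (y k) := by
    intro k
    induction k with
    | zero => exact hφ
    | succ k ih => rw [hyS]; exact continuous_step A₀ A₁ τ hφ ih
  have hstep : ∀ k : ℕ, ∀ t ≤ k * τ, y (k + 1) t = y k t := by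
    intro k
    induction k with
    | zero =>
      intro t ht
      rw [hyS]
      exact step_of_nonpos _ _ _ _ _ (by simpa using ht)
    | succ k ih =>
      intro t ht
      rw [hyS (k + 1), hyS k]
      refine step_congr A₀ A₁ τ φ (T := k * τ) ?_ ?_ (by positivity)
      · intro s hs
        rw [← hyS k]
        exact ih s hs
      · push_cast at ht; linarith
  have hmono : ∀ k m : ℕ, k ≤ m → ∀ t ≤ k * τ, y m t = y k t := by
    intro k m hkm
    induction m, hkm using Nat.le_induction with
    | base => exact fun _ _ => rfl
    | succ m hm ih =>
      intro t ht
      rw [hstep m t (ht.trans (by gcongr)), ih t ht]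
  have hceil : ∀ t : ℝ, t ≤ ⌈t / τ⌉₊ * τ := fun t => by
    have := Nat.le_ceil (t / τ)
    rwa [div_le_iff₀ hτ] at this
  let x : ℝ → Fin n → ℝ := fun t => y ⌈t / τ⌉₊ t
  have hxy : ∀ k : ℕ, ∀ t ≤ k * τ, x t = y k t := by
    intro k t ht
    rcases le_total k ⌈t / τ⌉₊ with h | h
    · exact hmono _ _ h t ht
    · exact (hmono _ _ h t (hceil t)).symm
  have hxc : Continuous x := by
    refine continuous_iff_continuousAt.2 fun t => ?_
    have hlt : t < (⌈t / τ⌉₊ + 1 : ℕ) * τ := by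
      have := hceil t
      push_cast; linarith
    refine (hyc (⌈t / τ⌉₊ + 1)).continuousAt.congr ?_
    filter_upwards [gt_mem_nhds hlt] with s hs
    exact (hxy _ s hs.le).symm
  have hfix : S x = x := by
    funext t
    have ht := hceil t
    set k := ⌈t / τ⌉₊
    rw [hxy k t ht, ← hstep k t ht, hyS]
    refine step_congr A₀ A₁ τ φ (T := k * τ) (hxy k) ?_ (by positivity)
    linarith
  refine ⟨x, hxc, ⟨hxc.continuousOn, fun t ht => ?_⟩, fun t ht => ?_⟩
  · have h := hasDerivAt_step A₀ A₁ τ φ hxc ht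
    change HasDerivAt (S x) (A₀ *ᵥ S x t + _) t at h
    rwa [hfix] at h
  · rw [← hfix]
    exact step_of_nonpos _ _ _ _ _ ht.2

theorem ExponentiallyStable.tendsto_zero {A₀ A₁ : Matrix (Fin n) (Fin n) ℝ} {τ : ℝ}
    (h : ExponentiallyStable A₀ A₁ τ) {x : ℝ → Fin n → ℝ} (hx : IsSolution A₀ A₁ τ x) :
    Tendsto x atTop (𝓝 0) := by
  obtain ⟨M, β, -, hβ, hb⟩ := h x hx
  have hlim : Tendsto (fun t => M * Real.exp (-β * t)) atTop (𝓝 0) := by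
    have : Tendsto (fun t : ℝ => -β * t) atTop atBot :=
      tendsto_id.const_mul_atTop_of_neg (neg_lt_zero.2 hβ)
    simpa using (Real.tendsto_exp_atBot.comp this).const_mul M
  have h2 : Tendsto (fun t => WithLp.toLp 2 (x t)) atTop (𝓝 0) := by
    refine squeeze_zero_norm' ?_ hlim
    filter_upwards [eventually_ge_atTop 0] with t ht using hb t ht
  exact ((PiLp.continuous_ofLp 2 fun _ : Fin n => ℝ).tendsto 0).comp h2

/-! ### The Lyapunov functional of a Lyapunov flow -/

/-- A matrix function with the dynamics of the delay Lyapunov matrix, where the delayed argument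
`V (t - τ)` has been replaced by `(V (τ - t))ᵀ`. Unlike the Lyapunov matrix, `V` satisfies its
equation, which is an ordinary one, on the whole line. -/
def IsLyapunovFlow (A₀ A₁ : Matrix (Fin n) (Fin n) ℝ) (τ : ℝ)
    (V : ℝ → Matrix (Fin n) (Fin n) ℝ) : Prop :=
  ∀ t, HasDerivAt V (V t * A₀ + (V (τ - t))ᵀ * A₁) t

theorem IsLyapunovFlow.continuous {A₀ A₁ : Matrix (Fin n) (Fin n) ℝ} {τ : ℝ}
    {V : ℝ → Matrix (Fin n) (Fin n) ℝ} (hV : IsLyapunovFlow A₀ A₁ τ V) : Continuous V :=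
  continuous_iff_continuousAt.2 fun t => HasDerivAt.continuousAt (F := Mat n) (hV t)

/-- The Lyapunov functional of `V`, with one of its two arguments left open, along a trajectory `x`
at time `t`. -/
noncomputable def costate (A₁ : Matrix (Fin n) (Fin n) ℝ) (τ : ℝ)
    (V : ℝ → Matrix (Fin n) (Fin n) ℝ) (x : ℝ → Fin n → ℝ) (t : ℝ) : Fin n → ℝ :=
  V 0 *ᵥ x t + ∫ u in (t - τ)..t, (V (u - t + τ))ᵀ *ᵥ (A₁ *ᵥ x u)

theorem costate_eq_integral (A₁ : Matrix (Fin n) (Fin n) ℝ) (τ : ℝ)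
    (V : ℝ → Matrix (Fin n) (Fin n) ℝ) (x : ℝ → Fin n → ℝ) (t : ℝ) :
    costate A₁ τ V x t = V 0 *ᵥ x t + ∫ s in 0..τ, (V s)ᵀ *ᵥ (A₁ *ᵥ x (t + s - τ)) := by
  have h := intervalIntegral.integral_comp_add_left (a := 0) (b := τ)
    (fun u => (V (u - t + τ))ᵀ *ᵥ (A₁ *ᵥ x u)) (t - τ)
  rw [costate, add_zero, sub_add_cancel] at *
  rw [← h]
  congr 1
  refine intervalIntegral.integral_congr fun s _ => ?_
  ring_nf

theorem continuous_costate {A₁ : Matrix (Fin n) (Fin n) ℝ} {τ : ℝ}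
    {V : ℝ → Matrix (Fin n) (Fin n) ℝ} (hV : Continuous V) {x : ℝ → Fin n → ℝ}
    (hx : Continuous x) : Continuous (costate A₁ τ V x) := by
  rw [funext (costate_eq_integral A₁ τ V x)]
  refine (Continuous.matrix_mulVec continuous_const hx).add ?_
  refine intervalIntegral.continuous_parametric_intervalIntegral_of_continuous'
    (f := fun t s => (V s)ᵀ *ᵥ (A₁ *ᵥ x (t + s - τ))) ?_ 0 τ
  exact Continuous.matrix_mulVec (hV.comp continuous_snd).matrix_transpose
    (Continuous.matrix_mulVec continuous_const (by fun_prop))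

theorem tendsto_costate {A₁ : Matrix (Fin n) (Fin n) ℝ} {τ : ℝ}
    {V : ℝ → Matrix (Fin n) (Fin n) ℝ} (hV : Continuous V) {x : ℝ → Fin n → ℝ}
    (hx : Continuous x) (hlim : Tendsto x atTop (𝓝 0)) :
    Tendsto (costate A₁ τ V x) atTop (𝓝 0) := by
  have h1 : Tendsto (fun t => V 0 *ᵥ x t) atTop (𝓝 0) := by
    have hc : Continuous fun v : Fin n → ℝ => V 0 *ᵥ v :=
      Continuous.matrix_mulVec continuous_const continuous_id
    simpa [Function.comp_def] using (hc.tendsto 0).comp hlim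
  have h2 := tendsto_integral_window (H := fun s v => (V s)ᵀ *ᵥ (A₁ *ᵥ v)) (f := fun t => x (t - τ))
    (Continuous.matrix_mulVec (hV.comp continuous_fst).matrix_transpose
      (Continuous.matrix_mulVec continuous_const continuous_snd)) (by simp) (by fun_prop)
    (hlim.comp (tendsto_atTop_add_const_right _ (-τ) tendsto_id)) 0 τ
  rw [funext (costate_eq_integral A₁ τ V x)]
  simpa using h1.add h2

/-- The costate is transported by the flow: its value at `t + τ` is expressed by `x` on the window
that ends at `t`. -/
theorem costate_add_delay {A₀ A₁ : Matrix (Fin n) (Fin n) ℝ} {τ : ℝ} (hτ : 0 ≤ τ)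
    {V : ℝ → Matrix (Fin n) (Fin n) ℝ} (hV : IsLyapunovFlow A₀ A₁ τ V) {x : ℝ → Fin n → ℝ}
    (hxc : Continuous x) (hx : IsSolution A₀ A₁ τ x) {t : ℝ} (ht : 0 ≤ t) :
    costate A₁ τ V x (t + τ) =
      V τ *ᵥ x t + ∫ u in (t - τ)..t, V (t - u) *ᵥ (A₁ *ᵥ x u) := by
  have hVc := hV.continuous
  have hP : Continuous fun u => V (t - u) *ᵥ (A₁ *ᵥ x u) :=
    Continuous.matrix_mulVec (by fun_prop) (Continuous.matrix_mulVec continuous_const hxc)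
  have hQ : Continuous fun u => (V (u - t))ᵀ *ᵥ (A₁ *ᵥ x u) :=
    Continuous.matrix_mulVec (Continuous.matrix_transpose (by fun_prop))
      (Continuous.matrix_mulVec continuous_const hxc)
  -- The window is moved back by `r`; the kernels do not depend on `r`, only the endpoints do.
  let h : ℝ → Fin n → ℝ := fun r => V r *ᵥ x (t + τ - r)
    + (∫ u in t..(t + τ - r), (V (u - t))ᵀ *ᵥ (A₁ *ᵥ x u))
    - ∫ u in t..(t - r), V (t - u) *ᵥ (A₁ *ᵥ x u)
  have hder : ∀ r < t + τ, HasDerivAt h 0 r := by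
    intro r hr
    have hT : HasDerivAt (fun r => t + τ - r) (-1) r := by
      simpa using (hasDerivAt_id r).const_sub (t + τ)
    have ht' : HasDerivAt (fun r => t - r) (-1) r := by
      simpa using (hasDerivAt_id r).const_sub t
    have h1 := hasDerivAt_mulVec (hV r)
      ((hx.hasDerivAt (t + τ - r) (by linarith)).scomp r hT)
    have h2 := (hQ.integral_hasStrictDerivAt t (t + τ - r)).hasDerivAt.scomp r hT
    have h3 := (hP.integral_hasStrictDerivAt t (t - r)).hasDerivAt.scomp r ht'
    refine ((h1.add h2).sub h3).congr_deriv ?_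
    rw [show t + τ - r - t = τ - r by ring, show t + τ - r - τ = t - r by ring,
      show t - (t - r) = r by ring]
    simp only [Function.comp_apply, Matrix.add_mulVec, Matrix.mulVec_add,
      Matrix.mulVec_mulVec, neg_smul, one_smul, smul_add, Matrix.mulVec_neg]
    abel
  have hcont : ContinuousOn h (Set.Icc 0 τ) := by
    have c2 := (intervalIntegral.continuous_primitive
      (fun a b => hQ.intervalIntegrable (μ := volume) a b) t)
    have c3 := (intervalIntegral.continuous_primitive
      (fun a b => hP.intervalIntegrable (μ := volume) a b) t)
    refine Continuous.continuousOn (((Continuous.matrix_mulVec hVc (by fun_prop)).add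
      (c2.comp (by fun_prop : Continuous fun r => t + τ - r))).sub
      (c3.comp (by fun_prop : Continuous fun r => t - r)))
  have hconst := constant_of_has_deriv_right_zero hcont
    (fun r hr => (hder r (by linarith [hr.2])).hasDerivWithinAt) τ ⟨hτ, le_rfl⟩
  have e0 : h 0 = costate A₁ τ V x (t + τ) := by
    simp only [h, costate, sub_zero, intervalIntegral.integral_same, add_sub_cancel_right]
    congr 2
    funext u
    congr 3; ring
  have eτ : h τ = V τ *ᵥ x t + ∫ u in (t - τ)..t, V (t - u) *ᵥ (A₁ *ᵥ x u) := by
    simp only [h, add_sub_cancel_right, intervalIntegral.integral_same, add_zero]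
    rw [intervalIntegral.integral_symm (t - τ) t, sub_neg_eq_add]
  rw [← e0, ← eτ, hconst]

/-- The costate solves the adjoint, advanced equation. The hypotheses `hsym` and `hjump` say that
`V`, extended to `[-τ, 0]` by `t ↦ (V (-t))ᵀ`, is continuous at `0` and its derivative has no jump
there. -/
theorem hasDerivAt_costate {A₀ A₁ : Matrix (Fin n) (Fin n) ℝ} {τ : ℝ} (hτ : 0 ≤ τ)
    {V : ℝ → Matrix (Fin n) (Fin n) ℝ} (hV : IsLyapunovFlow A₀ A₁ τ V) (hsym : (V 0)ᵀ = V 0)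
    (hjump : V 0 * A₀ + A₀ᵀ * V 0 + (V τ)ᵀ * A₁ + A₁ᵀ * V τ = 0) {x : ℝ → Fin n → ℝ}
    (hxc : Continuous x) (hx : IsSolution A₀ A₁ τ x) {t : ℝ} (ht : 0 < t) :
    HasDerivAt (costate A₁ τ V x)
      (-(A₀ᵀ *ᵥ costate A₁ τ V x t) - A₁ᵀ *ᵥ costate A₁ τ V x (t + τ)) t := by
  have hVc := hV.continuous
  have hcx : Continuous fun u => A₁ *ᵥ x u := Continuous.matrix_mulVec continuous_const hxc
  have hL := hasDerivAt_integral_window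
    (F := fun t u => (V (u - t + τ))ᵀ *ᵥ (A₁ *ᵥ x u))
    (F' := fun t u => -(A₀ᵀ *ᵥ ((V (u - t + τ))ᵀ *ᵥ (A₁ *ᵥ x u)))
      - A₁ᵀ *ᵥ (V (t - u) *ᵥ (A₁ *ᵥ x u))) ?_ ?_ ?_ (-τ) 0 t
  · have h0 := hasDerivAt_mulVec (hasDerivAt_matrix_const (V 0) t) (hx.hasDerivAt t ht)
    simp only [add_zero, ← sub_eq_add_neg] at hL
    refine (h0.add hL).congr_deriv ?_
    have hI1 : Continuous fun u => (V (u - t + τ))ᵀ *ᵥ (A₁ *ᵥ x u) :=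
      Continuous.matrix_mulVec (Continuous.matrix_transpose (by fun_prop)) hcx
    have hI2 : Continuous fun u => V (t - u) *ᵥ (A₁ *ᵥ x u) :=
      Continuous.matrix_mulVec (by fun_prop) hcx
    have hJ1 : Continuous fun u => -(A₀ᵀ *ᵥ ((V (u - t + τ))ᵀ *ᵥ (A₁ *ᵥ x u))) :=
      (Continuous.matrix_mulVec continuous_const hI1).neg
    have hJ2 : Continuous fun u => A₁ᵀ *ᵥ (V (t - u) *ᵥ (A₁ *ᵥ x u)) :=
      Continuous.matrix_mulVec continuous_const hI2
    rw [costate_add_delay hτ hV hxc hx ht.le, costate, Matrix.mulVec_add A₀ᵀ, Matrix.mulVec_add A₁ᵀ,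
      mulVec_intervalIntegral _ hI1, mulVec_intervalIntegral _ hI2,
      intervalIntegral.integral_sub (hJ1.intervalIntegrable _ _) (hJ2.intervalIntegrable _ _),
      intervalIntegral.integral_neg]
    have hj := congrArg (· *ᵥ x t) hjump
    simp only [Matrix.add_mulVec, Matrix.zero_mulVec] at hj
    have e1 : t - t + τ = τ := by ring
    have e2 : t - τ - t + τ = 0 := by ring
    rw [e1, e2, hsym, Matrix.zero_mulVec]
    simp only [Matrix.mulVec_add, Matrix.mulVec_mulVec] at hj ⊢
    refine sub_eq_zero.1 (Eq.trans ?_ hj)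
    abel
  · exact Continuous.matrix_mulVec (Continuous.matrix_transpose (by fun_prop))
      (hcx.comp continuous_snd)
  · refine Continuous.sub (Continuous.neg (Continuous.matrix_mulVec continuous_const ?_))
      (Continuous.matrix_mulVec continuous_const ?_)
    · exact Continuous.matrix_mulVec (Continuous.matrix_transpose (by fun_prop))
        (hcx.comp continuous_snd)
    · exact Continuous.matrix_mulVec (by fun_prop) (hcx.comp continuous_snd)
  · intro t u
    have hin : HasDerivAt (fun s => u - s + τ) (-1) t := by
      simpa using ((hasDerivAt_id t).const_sub u).add_const τ
    have hVt := hasDerivAt_matrix_comp_of_neg_one (f := fun s => u - s + τ) (hV (u - t + τ)) hin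
    have h := hasDerivAt_mulVec (hasDerivAt_transpose hVt) (hasDerivAt_const t (A₁ *ᵥ x u))
    refine h.congr_deriv ?_
    rw [show τ - (u - t + τ) = t - u by ring]
    simp only [Matrix.mulVec_zero, add_zero, Matrix.mulVec_mulVec, Matrix.transpose_neg,
      Matrix.transpose_add, Matrix.transpose_mul, Matrix.transpose_transpose, Matrix.add_mul,
      Matrix.neg_mul, Matrix.neg_mulVec, Matrix.add_mulVec, Matrix.mul_assoc]
    abel

/-- The bilinear Lyapunov functional is constant along solutions, and it vanishes because solutions
decay. -/
theorem costate_pairing_eq_zero {A₀ A₁ : Matrix (Fin n) (Fin n) ℝ} {τ : ℝ} (hτ : 0 ≤ τ)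
    (hstable : ExponentiallyStable A₀ A₁ τ)
    {V : ℝ → Matrix (Fin n) (Fin n) ℝ} (hV : IsLyapunovFlow A₀ A₁ τ V) (hsym : (V 0)ᵀ = V 0)
    (hjump : V 0 * A₀ + A₀ᵀ * V 0 + (V τ)ᵀ * A₁ + A₁ᵀ * V τ = 0) {x y : ℝ → Fin n → ℝ}
    (hxc : Continuous x) (hx : IsSolution A₀ A₁ τ x)
    (hyc : Continuous y) (hy : IsSolution A₀ A₁ τ y) :
    costate A₁ τ V x 0 ⬝ᵥ y 0
      + ∫ s in 0..τ, costate A₁ τ V x s ⬝ᵥ (A₁ *ᵥ y (s - τ)) = 0 := by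
  set q := costate A₁ τ V x with hq
  have hqc : Continuous q := continuous_costate hV.continuous hxc
  have hgc : Continuous fun s => q s ⬝ᵥ (A₁ *ᵥ y (s - τ)) :=
    hqc.dotProduct (Continuous.matrix_mulVec continuous_const (by fun_prop))
  let B : ℝ → ℝ := fun t => q t ⬝ᵥ y t + ∫ s in 0..τ, q (t + s) ⬝ᵥ (A₁ *ᵥ y (t + s - τ))
  have hB : ∀ t, B t = q t ⬝ᵥ y t + ((∫ s in 0..(t + τ), q s ⬝ᵥ (A₁ *ᵥ y (s - τ)))
      - ∫ s in 0..t, q s ⬝ᵥ (A₁ *ᵥ y (s - τ))) := by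
    intro t
    have h := intervalIntegral.integral_comp_add_left (a := 0) (b := τ)
      (fun s => q s ⬝ᵥ (A₁ *ᵥ y (s - τ))) t
    rw [intervalIntegral.integral_interval_sub_left (hgc.intervalIntegrable _ _)
      (hgc.intervalIntegrable _ _)]
    simp only [B, h, add_zero]
  have hder : ∀ t, 0 < t → HasDerivAt B 0 t := by
    intro t ht
    rw [funext hB]
    have hq' := hasDerivAt_costate hτ hV hsym hjump hxc hx ht
    have h1 := hasDerivAt_dotProduct hq' (hy.hasDerivAt t ht)
    have h2 := (hgc.integral_hasStrictDerivAt 0 (t + τ)).hasDerivAt.comp_add_const t τ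
    have h3 := (hgc.integral_hasStrictDerivAt 0 t).hasDerivAt
    refine (h1.add (h2.sub h3)).congr_deriv ?_
    rw [add_sub_cancel_right, ← hq]
    simp only [sub_dotProduct, neg_dotProduct, dotProduct_add, Matrix.mulVec_transpose,
      Matrix.dotProduct_mulVec]
    ring
  have hBc : Continuous B := by
    rw [funext hB]
    have c := intervalIntegral.continuous_primitive
      (fun a b => hgc.intervalIntegrable (μ := volume) a b) 0
    exact (hqc.dotProduct hyc).add ((c.comp (by fun_prop : Continuous fun t => t + τ)).sub c)
  have hlimq : Tendsto q atTop (𝓝 0) :=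
    tendsto_costate hV.continuous hxc (hstable.tendsto_zero hx)
  have hlimy := hstable.tendsto_zero hy
  have hlim1 : ∀ M : Matrix (Fin n) (Fin n) ℝ, ∀ z : ℝ → Fin n → ℝ, Tendsto z atTop (𝓝 0) →
      Tendsto (fun t => q t ⬝ᵥ (M *ᵥ z t)) atTop (𝓝 0) := by
    intro M z hz
    have hc : Continuous fun p : (Fin n → ℝ) × (Fin n → ℝ) => p.1 ⬝ᵥ (M *ᵥ p.2) :=
      continuous_fst.dotProduct (Continuous.matrix_mulVec continuous_const continuous_snd)
    simpa [Function.comp_def] using (hc.tendsto (0, 0)).comp (hlimq.prodMk_nhds hz)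
  have hlimB : Tendsto B atTop (𝓝 0) := by
    have h1 := hlim1 1 y hlimy
    have h2 := tendsto_integral_window (H := fun _ v : ℝ => v)
      (f := fun s => q s ⬝ᵥ (A₁ *ᵥ y (s - τ))) continuous_snd (fun _ => rfl) hgc
      (hlim1 A₁ _ (hlimy.comp (tendsto_atTop_add_const_right _ (-τ) tendsto_id))) 0 τ
    simp only [Matrix.one_mulVec] at h1
    simpa using h1.add h2
  have hconst : ∀ T, 0 < T → B T = B 0 := by
    intro T hT
    -- the derivative is known at positive times only; continuity carries the value to time `0`
    have h : ∀ a ∈ Set.Ioo 0 T, B T = B a := fun a ha =>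
      constant_of_has_deriv_right_zero hBc.continuousOn
        (fun r hr => (hder r (ha.1.trans_le hr.1)).hasDerivWithinAt) T ⟨ha.2.le, le_rfl⟩
    have hc : Set.EqOn (fun _ => B T) B (closure (Set.Ioo 0 T)) :=
      Set.EqOn.closure h continuous_const hBc
    rw [closure_Ioo hT.ne] at hc
    exact hc ⟨le_rfl, hT.le⟩
  have h0 : B 0 = 0 := by
    refine tendsto_nhds_unique (tendsto_const_nhds.congr' ?_) hlimB
    filter_upwards [eventually_gt_atTop 0] with T hT using (hconst T hT).symm
  simpa [B] using h0

/-- The pairing of the costate with solutions `y` vanishes for every initial function of `y`, which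
forces the costate to vanish at time `0`. -/
theorem costate_zero_eq_zero {A₀ A₁ : Matrix (Fin n) (Fin n) ℝ} {τ : ℝ} (hτ : 0 ≤ τ)
    (hstable : ExponentiallyStable A₀ A₁ τ)
    {V : ℝ → Matrix (Fin n) (Fin n) ℝ} (hV : IsLyapunovFlow A₀ A₁ τ V) (hsym : (V 0)ᵀ = V 0)
    (hjump : V 0 * A₀ + A₀ᵀ * V 0 + (V τ)ᵀ * A₁ + A₁ᵀ * V τ = 0) {x : ℝ → Fin n → ℝ}
    (hxc : Continuous x) (hx : IsSolution A₀ A₁ τ x) : costate A₁ τ V x 0 = 0 := by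
  refine (eq_zero_of_forall_dotProduct_add_integral_eq_zero hτ
    (g := fun s => A₁ᵀ *ᵥ costate A₁ τ V x s)
    (Continuous.matrix_mulVec continuous_const (continuous_costate hV.continuous hxc))
    fun ψ hψ => ?_).1
  obtain ⟨y, hyc, hy, hyψ⟩ := exists_solution A₀ A₁ hτ hψ
  have h := costate_pairing_eq_zero hτ hstable hV hsym hjump hxc hx hyc hy
  rw [hyψ 0 (by simpa using hτ)] at h
  refine Eq.trans (congrArg _ ?_) h
  refine intervalIntegral.integral_congr fun s hs => ?_
  rw [Set.uIcc_of_le hτ] at hs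
  simp only [Matrix.mulVec_transpose, Matrix.dotProduct_mulVec]
  rw [hyψ (s - τ) ⟨by linarith [hs.1], by linarith [hs.2]⟩]

/-- Under exponential stability the homogeneous problem for the delay Lyapunov matrix has only the
trivial solution. -/
theorem IsLyapunovFlow.eq_zero {A₀ A₁ : Matrix (Fin n) (Fin n) ℝ} {τ : ℝ} (hτ : 0 ≤ τ)
    (hstable : ExponentiallyStable A₀ A₁ τ)
    {V : ℝ → Matrix (Fin n) (Fin n) ℝ} (hV : IsLyapunovFlow A₀ A₁ τ V) (hsym : (V 0)ᵀ = V 0)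
    (hjump : V 0 * A₀ + A₀ᵀ * V 0 + (V τ)ᵀ * A₁ + A₁ᵀ * V τ = 0) :
    ∀ t ∈ Set.Icc 0 τ, V t = 0 := by
  have hVc := hV.continuous
  have hrow : ∀ i, V 0 i = 0 ∧ (0 < τ → ∀ s ∈ Set.Icc 0 τ, ((V s)ᵀ * A₁) i = 0) := by
    intro i
    refine eq_zero_of_forall_dotProduct_add_integral_eq_zero hτ
      (g := fun s => ((V s)ᵀ * A₁) i)
      ((continuous_apply i).comp (hVc.matrix_transpose.matrix_mul continuous_const))
      fun φ hφ => ?_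
    obtain ⟨x, hxc, hx, hxφ⟩ := exists_solution A₀ A₁ hτ hφ
    have h := congrFun (costate_zero_eq_zero hτ hstable hV hsym hjump hxc hx) i
    rw [costate_eq_integral, Pi.add_apply, hxφ 0 (by simpa using hτ), Pi.zero_apply] at h
    have hc : Continuous fun s => (V s)ᵀ *ᵥ (A₁ *ᵥ x (0 + s - τ)) :=
      Continuous.matrix_mulVec hVc.matrix_transpose
        (Continuous.matrix_mulVec continuous_const (by fun_prop))
    have hproj := (ContinuousLinearMap.proj (R := ℝ) (φ := fun _ : Fin n => ℝ)
      i).intervalIntegral_comp_comm (hc.intervalIntegrable (μ := volume) 0 τ)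
    simp only [ContinuousLinearMap.proj_apply] at hproj
    rw [← hproj] at h
    refine Eq.trans (congrArg _ ?_) h
    refine intervalIntegral.integral_congr fun s hs => ?_
    rw [Set.uIcc_of_le hτ] at hs
    simp only [zero_add, Matrix.mulVec_mulVec]
    rw [hxφ (s - τ) ⟨by linarith [hs.1], by linarith [hs.2]⟩]
    rfl
  have h0 : V 0 = 0 := funext fun i => (hrow i).1
  rcases hτ.eq_or_lt with rfl | hτ'
  · intro t ht
    obtain rfl : t = 0 := by simpa using ht
    exact h0
  have hA : ∀ s ∈ Set.Icc 0 τ, (V s)ᵀ * A₁ = 0 := fun s hs => funext fun i => (hrow i).2 hτ' s hs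
  -- the delayed term has dropped out, which leaves `V' = V A₀`
  let R : Mat n →L[ℝ] Mat n :=
    LinearMap.toContinuousLinearMap (E := Mat n)
      (LinearMap.mulRight ℝ A₀ : Matrix (Fin n) (Fin n) ℝ →ₗ[ℝ] Matrix (Fin n) (Fin n) ℝ)
  have hR : ∀ M : Matrix (Fin n) (Fin n) ℝ, R M = M * A₀ := fun _ => rfl
  have h := linear_flow_eqOn R (T := τ) (z := V) (y := fun _ => 0) h0
    (fun t ht => by
      have e := hV t
      rw [hA (τ - t) ⟨by linarith [ht.2], by linarith [ht.1]⟩, add_zero, ← hR] at e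
      exact HasDerivAt.hasDerivWithinAt e)
    (fun t _ => by rw [map_zero]; exact hasDerivWithinAt_const _ _ _)
  exact fun t ht => h ht

/-! ### The flow obtained from the initial value problem -/

/-- Gluing `Z₁` and `Z₂`: the shifted solution of the initial value problem is a Lyapunov flow whose
value at `τ / 2` is the initial value. -/
theorem exists_isLyapunovFlow (A₀ A₁ : Matrix (Fin n) (Fin n) ℝ) {τ : ℝ} (hτ : 0 ≤ τ)
    (X : Matrix (Fin n) (Fin n) ℝ) :
    ∃ V : ℝ → Matrix (Fin n) (Fin n) ℝ, IsLyapunovFlow A₀ A₁ τ V ∧ V (τ / 2) = X ∧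
      V 0 = Z₂ A₀ A₁ τ X (τ / 2) ∧ V τ = Z₁ A₀ A₁ τ X (τ / 2) := by
  obtain ⟨z, h0, hz⟩ := exists_linear_flow (fieldL A₀ A₁) (X, X)
  have h1 : ∀ t, HasDerivAt (F := Mat n) (fun s => (z s).1) (fieldL A₀ A₁ (z t)).1 t := fun t =>
    (ContinuousLinearMap.fst ℝ (Mat n) (Mat n)).hasFDerivAt.comp_hasDerivAt t (hz t)
  have h2 : ∀ t, HasDerivAt (F := Mat n) (fun s => (z s).2) (fieldL A₀ A₁ (z t)).2 t := fun t =>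
    (ContinuousLinearMap.snd ℝ (Mat n) (Mat n)).hasFDerivAt.comp_hasDerivAt t (hz t)
  have hfield₂ : ∀ P Q : Matrix (Fin n) (Fin n) ℝ,
      -(-(Pᵀ * A₁) - Q * A₀) = Q * A₀ + Pᵀ * A₁ := fun P Q => by abel
  have hfield₁ : ∀ P Q : Matrix (Fin n) (Fin n) ℝ,
      -(P * A₀ + Qᵀ * A₁) = -(Qᵀ * A₁) - P * A₀ := fun P Q => by abel
  -- Time reversal exchanges the two components.
  have hrev : ∀ t, HasDerivAt (F := Mat n × Mat n) (fun s => ((z (-s)).2, (z (-s)).1))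
      (fieldL A₀ A₁ ((z (-t)).2, (z (-t)).1)) t := by
    intro t
    have r1 := hasDerivAt_matrix_comp_of_neg_one (h1 (-t)) (hasDerivAt_neg t)
    have r2 := hasDerivAt_matrix_comp_of_neg_one (h2 (-t)) (hasDerivAt_neg t)
    refine (HasDerivAt.prodMk (F := Mat n) (G := Mat n) r2 r1).congr_deriv (Prod.ext ?_ ?_)
    · exact hfield₂ (z (-t)).1 (z (-t)).2
    · exact hfield₁ (z (-t)).1 (z (-t)).2
  have hswap : ∀ t, 0 ≤ t → z t = ((z (-t)).2, (z (-t)).1) := by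
    intro t ht
    refine linear_flow_eqOn (fieldL A₀ A₁) (T := t) (y := fun s => ((z (-s)).2, (z (-s)).1)) ?_
      (fun s _ => (hz s).hasDerivWithinAt) (fun s _ => (hrev s).hasDerivWithinAt) ⟨ht, le_rfl⟩
    simp [h0]
  have h21 : ∀ t, (z t).2 = (z (-t)).1 := by
    intro t
    rcases le_total 0 t with ht | ht
    · exact congrArg Prod.snd (hswap t ht)
    · have := congrArg Prod.fst (hswap (-t) (by linarith))
      rw [neg_neg] at this
      exact this.symm
  have hZ : IsZPair A₀ A₁ τ X (fun s => (z s).1) (fun s => (z s).2) :=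
    ⟨congrArg Prod.fst h0, congrArg Prod.snd h0,
      fun t _ => (h1 t).hasDerivWithinAt, fun t _ => (h2 t).hasDerivWithinAt⟩
  have hmem : τ / 2 ∈ Set.Icc 0 (τ / 2) := ⟨by positivity, le_rfl⟩
  have heq := (isZPair A₀ A₁ τ X).eqOn hZ
  refine ⟨fun t => (z (t - τ / 2)).1, fun t => ?_, ?_, ?_, ?_⟩
  · have h := (h1 (t - τ / 2)).comp_sub_const t (τ / 2)
    have e : (z (t - τ / 2)).2 = (z (τ - t - τ / 2)).1 :=
      (h21 _).trans (congrArg (fun s => (z s).1) (by ring))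
    refine HasDerivAt.congr_deriv (F := Mat n) h ?_
    let P : Matrix (Fin n) (Fin n) ℝ := (z (t - τ / 2)).1
    exact congrArg (fun Q : Matrix (Fin n) (Fin n) ℝ => P * A₀ + Qᵀ * A₁) e
  · exact (congrArg (fun s => (z s).1) (sub_self _)).trans (congrArg Prod.fst h0)
  · rw [heq.2 hmem]
    exact ((h21 _).trans (congrArg (fun s => (z s).1) (by ring))).symm
  · rw [heq.1 hmem]
    exact congrArg (fun s => (z s).1) (by ring)

end DelayLyapunov

theorem corollary1 {n : ℕ} (A₀ A₁ : Matrix (Fin n) (Fin n) ℝ) (τ : ℝ) (hτ : 0 ≤ τ)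
    (hstable : DelayLyapunov.ExponentiallyStable A₀ A₁ τ) :
    ∀ c : ℝ, c ≠ 0 → Function.Bijective (DelayLyapunov.Lc A₀ A₁ τ hτ c) := by
  intro c hc
  suffices hinj : Function.Injective (DelayLyapunov.Lc A₀ A₁ τ hτ c) from
    ⟨hinj, LinearMap.injective_iff_surjective.1 hinj⟩
  rw [injective_iff_map_eq_zero]
  intro X hX
  obtain ⟨V, hV, hVX, hV0, hVτ⟩ := DelayLyapunov.exists_isLyapunovFlow A₀ A₁ hτ X
  have hL : (V 0)ᵀ * (A₀ - c • 1) + (A₀ᵀ + c • 1) * V 0 + (V τ)ᵀ * A₁ + A₁ᵀ * V τ = 0 := by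
    rw [hV0, hVτ]; exact hX
  have hL' : (V 0)ᵀ * A₀ + A₀ᵀ * V 0 + (V τ)ᵀ * A₁ + A₁ᵀ * V τ = c • ((V 0)ᵀ - V 0) := by
    rw [← sub_eq_zero, ← hL]
    simp only [mul_sub, add_mul, Matrix.mul_smul, Matrix.smul_mul, mul_one, one_mul, smul_sub]
    abel
  -- The left side is symmetric and the right side antisymmetric, so both vanish.
  have hLt := congrArg Matrix.transpose hL'
  simp only [Matrix.transpose_add, Matrix.transpose_mul, Matrix.transpose_transpose,
    Matrix.transpose_smul, Matrix.transpose_sub] at hLt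
  have hsum : (2 * c) • ((V 0)ᵀ - V 0) = 0 := by
    have e : c • ((V 0)ᵀ - V 0) = c • (V 0 - (V 0)ᵀ) := by
      rw [← hL', ← hLt]; abel
    rw [mul_smul, two_smul]
    nth_rewrite 2 [e]
    rw [← smul_add]; simp
  have hsym : (V 0)ᵀ = V 0 :=
    sub_eq_zero.1 ((smul_eq_zero.1 hsum).resolve_left (mul_ne_zero two_ne_zero hc))
  rw [hsym, sub_self, smul_zero] at hL'
  rw [← hVX]
  exact hV.eq_zero hτ hstable hsym hL' (τ / 2) ⟨by positivity, by linarith⟩
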